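/- Let $n\ge 0$. For a matrix $A\in\mathbb{R}^{n\times n}$ and a vector $x\in\mathbb{R}^n$ let $A[x]$ denote the matrix obtained from $A$ by replacing its diagonal with $x$ (so $A[x]_{ii}=x_i$ and $A[x]_{ij}=A_{ij}$ for $i\ne j$), and for a square matrix $M$ let $\mathrm{diag}(M)=(M_{11},\dots,M_{nn})'$ denote the vector of its diagonal entries. Write $e^{M}=\sum_{k\ge 0}M^k/k!$, and let $\log$ of a vector with positive entries be taken element-wise. A covariance matrix is a matrix of the form $(\mathrm{Cov}(X_i,X_j))_{i,j}$ for some square-integrable real random vector $(X_1,\dots,X_n)$. For any real symmetric matrix $A\in\mathbb{R}^{n\times n}$ and any vector $v\in\mathbb{R}^n$ with strictly positive elements, there exists a unique vector $x^{\ast}\in\mathbb{R}^n$ such that $\Sigma=e^{A[x^{\ast}]}$ is a covariance matrix with diagonal $\mathrm{diag}(\Sigma)=v$. Moreover, for an arbitrary initial vector $x_{(0)}\in\mathbb{R}^n$, the sequence defined by $$x_{(k+1)}=x_{(k)}+\bigl[\log v-\log\mathrm{diag}(e^{A[x_{(k)}]})\bigr],\qquad k=0,1,2,\dots,$$ converges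 to $x^{\ast}$. -/

import Mathlib

open Filter Topology

/-- `A[x]`: the matrix `A` where the vector `x` has replaced its diagonal. -/
def replaceDiag {n : ℕ} (A : Matrix (Fin n) (Fin n) ℝ) (x : Fin n → ℝ) :
    Matrix (Fin n) (Fin n) ℝ :=
  Matrix.of fun i j => if i = j then x i else A i j

/-- `S` is a covariance matrix: it is the matrix of the covariances of the coordinates of some
square-integrable real random vector `X = (X₁, …, Xₙ)`. -/
def IsCovarianceMatrix {n : ℕ} (S : Matrix (Fin n) (Fin n) ℝ) : Prop :=
  ∃ (Ω : Type) (_ : MeasurableSpace Ω) (P : MeasureTheory.Measure Ω) (X : Fin n → Ω → ℝ),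
    MeasureTheory.IsProbabilityMeasure P ∧
    (∀ i, MeasureTheory.MemLp (X i) 2 P) ∧
    ∀ i j, S i j = ProbabilityTheory.covariance (X i) (X j) P

/-- The matrix exponential `e^{A[x]}`. -/
noncomputable def expReplaceDiag {n : ℕ} (A : Matrix (Fin n) (Fin n) ℝ) (x : Fin n → ℝ) :
    Matrix (Fin n) (Fin n) ℝ :=
  NormedSpace.exp (replaceDiag A x)

/-- The logarithm of a vector, applied element-wise. -/
noncomputable def vecLog {n : ℕ} (v : Fin n → ℝ) : Fin n → ℝ :=
  fun i => Real.log (v i)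

/-! The equation for `x` is the critical point equation of the convex function `φ(x) = tr e^{A[x]} -
∑ v i * x i` (`diagPotential`), and the iteration is a descent method for it. Golden–Thompson, with
the update `d` as a diagonal matrix, gives `tr e^{A[x] + diag d} ≤ tr (e^{A[x]} e^{diag d}) = ∑ v
i`. Hence each step lowers `φ` by at least a generalized Kullback–Leibler divergence, which vanishes
only where the diagonal is `v` (`diagPotential_step_le`). Klein's inequality does the rest: its
equality case gives uniqueness, and comparison of `A[x]` with `diag x` bounds `φ` below by a
coercive function, so that sublevel sets are compact. Every orbit therefore has cluster points, all
of which solve the equation; there is only one solution, so the orbit converges. Existence comes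
from the same cluster points. -/

/-! ### Trace inequalities for powers of order `2 ^ k` -/

section TraceInequalities

open scoped Matrix

variable {m : Type*} [Fintype m] [DecidableEq m]

theorem Matrix.trace_mul_pow_comm (A B : Matrix m m ℝ) (j : ℕ) :
    ((A * B) ^ j).trace = ((B * A) ^ j).trace := by
  cases j with
  | zero => simp
  | succ j =>
    have h : A * (B * A) ^ j = (A * B) ^ j * A :=
      (show SemiconjBy A (B * A) (A * B) by simp [SemiconjBy, mul_assoc]).pow_right j
    rw [pow_succ (A * B), ← mul_assoc, ← h, pow_succ (B * A), ← mul_assoc ((B * A) ^ j),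
      mul_assoc A, Matrix.trace_mul_comm, mul_assoc]

theorem Matrix.trace_sq_le_trace_mul_transpose (M : Matrix m m ℝ) :
    (M ^ 2).trace ≤ (M * Mᵀ).trace := by
  have h : 0 ≤ ((M - Mᵀ) * (M - Mᵀ)ᵀ).trace := by
    simpa using (Matrix.posSemidef_self_mul_conjTranspose (M - Mᵀ)).trace_nonneg
  have h1 : (Mᵀ * Mᵀ).trace = (M * M).trace := by
    rw [← Matrix.transpose_mul, Matrix.trace_transpose]
  have h2 : (Mᵀ * M).trace = (M * Mᵀ).trace := Matrix.trace_mul_comm _ _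
  simp only [Matrix.transpose_sub, Matrix.transpose_transpose, sub_mul, mul_sub,
    Matrix.trace_sub] at h
  rw [pow_two]
  linarith

theorem Matrix.IsSymm.trace_mul_le {P Q : Matrix m m ℝ} (hP : P.IsSymm) (hQ : Q.IsSymm) :
    (P * Q).trace ≤ ((P ^ 2).trace + (Q ^ 2).trace) / 2 := by
  have h : 0 ≤ ((P - Q) * (P - Q)ᵀ).trace := by
    simpa using (Matrix.posSemidef_self_mul_conjTranspose (P - Q)).trace_nonneg
  have h2 : (Q * P).trace = (P * Q).trace := Matrix.trace_mul_comm _ _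
  simp only [Matrix.transpose_sub, hP.eq, hQ.eq, sub_mul, mul_sub, Matrix.trace_sub] at h
  rw [pow_two, pow_two]
  linarith

theorem Matrix.trace_mul_mul_transpose_pow {P Q : Matrix m m ℝ} (hP : P.IsSymm) (hQ : Q.IsSymm)
    (j : ℕ) : ((P * Q * (P * Q)ᵀ) ^ j).trace = ((P ^ 2 * Q ^ 2) ^ j).trace := by
  rw [Matrix.transpose_mul, hP.eq, hQ.eq, ← mul_assoc, Matrix.trace_mul_pow_comm]
  simp only [pow_two, mul_assoc]

/-- The two claims are proved by a joint induction: squaring `M` reduces the first to the second for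
`MᵀM` and `MMᵀ`, whose powers have equal traces; the first, applied to `P * Q`, reduces the second
to `P ^ 2` and `Q ^ 2`. -/
theorem Matrix.trace_pow_two_pow_le_aux (k : ℕ) :
    (∀ M : Matrix m m ℝ, (M ^ 2 ^ (k + 1)).trace ≤ ((M * Mᵀ) ^ 2 ^ k).trace) ∧
    ∀ P Q : Matrix m m ℝ, P.IsSymm → Q.IsSymm →
      ((P * Q) ^ 2 ^ k).trace ≤ ((P ^ 2 ^ (k + 1)).trace + (Q ^ 2 ^ (k + 1)).trace) / 2 := by
  induction k with
  | zero =>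
    exact ⟨fun M => by simpa using M.trace_sq_le_trace_mul_transpose,
      fun P Q hP hQ => by simpa using hP.trace_mul_le hQ⟩
  | succ k ih =>
    obtain ⟨ih1, ih2⟩ := ih
    refine ⟨fun M => ?_, fun P Q hP hQ => ?_⟩
    · have h2 := ih2 (Mᵀ * M) (M * Mᵀ) (Matrix.isSymm_transpose_mul_self M)
        (Matrix.isSymm_mul_transpose_self M)
      rw [Matrix.trace_mul_pow_comm Mᵀ M, add_self_div_two] at h2
      refine le_trans (le_of_eq ?_) ((ih1 (M ^ 2)).trans (le_trans (le_of_eq ?_) h2))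
      · rw [← pow_mul, ← pow_succ']
      · rw [show M ^ 2 * (M ^ 2)ᵀ = M * (M * Mᵀ * Mᵀ) by
          simp only [pow_two, Matrix.transpose_mul, mul_assoc], Matrix.trace_mul_pow_comm]
        rw [show M * Mᵀ * Mᵀ * M = (M * Mᵀ) * (Mᵀ * M) by simp only [mul_assoc],
          Matrix.trace_mul_pow_comm]
    · refine (ih1 (P * Q)).trans ?_
      rw [Matrix.trace_mul_mul_transpose_pow hP hQ]
      refine (ih2 _ _ (hP.pow 2) (hQ.pow 2)).trans (le_of_eq ?_)
      rw [← pow_mul, ← pow_mul, ← pow_succ']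

theorem Matrix.trace_mul_pow_two_pow_le (k : ℕ) (P Q : Matrix m m ℝ) (hP : P.IsSymm)
    (hQ : Q.IsSymm) : ((P * Q) ^ 2 ^ k).trace ≤ (P ^ 2 ^ k * Q ^ 2 ^ k).trace := by
  induction k generalizing P Q with
  | zero => simp
  | succ k ih =>
    refine ((Matrix.trace_pow_two_pow_le_aux k).1 (P * Q)).trans ?_
    rw [Matrix.trace_mul_mul_transpose_pow hP hQ]
    refine (ih _ _ (hP.pow 2) (hQ.pow 2)).trans (le_of_eq ?_)
    rw [← pow_mul, ← pow_mul, ← pow_succ']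

end TraceInequalities

/-! ### Lie product formula -/

section LieTrotter

variable {𝔸 : Type*} [NormedRing 𝔸] [NormOneClass 𝔸]

/-- Telescoping; the factor `K` on the left avoids the exponent `j - 1`. -/
theorem norm_pow_sub_pow_le {a b : 𝔸} {K : ℝ} (ha : ‖a‖ ≤ K) (hb : ‖b‖ ≤ K)
    (j : ℕ) : ‖a ^ j - b ^ j‖ * K ≤ j * K ^ j * ‖a - b‖ := by
  have hK : 0 ≤ K := (norm_nonneg a).trans ha
  induction j with
  | zero => simp
  | succ j ih =>
    have h : a ^ (j + 1) - b ^ (j + 1) = a ^ j * (a - b) + (a ^ j - b ^ j) * b := by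
      rw [pow_succ, pow_succ]; noncomm_ring
    have h1 : ‖a ^ j‖ ≤ K ^ j := (norm_pow_le a j).trans (by gcongr)
    have h2 : ‖a ^ (j + 1) - b ^ (j + 1)‖ ≤ K ^ j * ‖a - b‖ + ‖a ^ j - b ^ j‖ * K := by
      rw [h]
      refine (norm_add_le _ _).trans (add_le_add ?_ ?_)
      · exact (norm_mul_le _ _).trans (by gcongr)
      · exact (norm_mul_le _ _).trans (by gcongr)
    calc _ ≤ (K ^ j * ‖a - b‖ + j * K ^ j * ‖a - b‖) * K := by
          gcongr; exact h2.trans (by gcongr)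
      _ = _ := by push_cast; ring

variable [NormedAlgebra ℝ 𝔸]

/-- Two curves through `1` with the same velocity there have asymptotically equal powers. -/
theorem tendsto_pow_sub_pow_of_hasDerivAt {f g : ℝ → 𝔸} {c : 𝔸} (hf : HasDerivAt f c 0)
    (hg : HasDerivAt g c 0) (hf0 : f 0 = 1) (hg0 : g 0 = 1) :
    Tendsto (fun j : ℕ => f (j : ℝ)⁻¹ ^ j - g (j : ℝ)⁻¹ ^ j) atTop (𝓝 0) := by
  have hinv : Tendsto (fun j : ℕ => (j : ℝ)⁻¹) atTop (𝓝 0) := tendsto_inv_atTop_nhds_zero_nat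
  -- The extra `1` beside `‖c‖` absorbs the `o(1/j)` remainder.
  have key : ∀ {h : ℝ → 𝔸}, HasDerivAt h c 0 → h 0 = 1 →
      ∀ᶠ j : ℕ in atTop, ‖h (j : ℝ)⁻¹‖ ≤ 1 + (‖c‖ + 1) * (j : ℝ)⁻¹ := by
    intro h hh hh0
    have h1 := (hh.isLittleO.def (c := 1) one_pos)
    filter_upwards [hinv.eventually h1] with j hj
    simp only [sub_zero, hh0, one_mul] at hj
    have hn : ‖(j : ℝ)⁻¹‖ = (j : ℝ)⁻¹ := by rw [Real.norm_eq_abs, abs_of_nonneg (by positivity)]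
    rw [hn] at hj
    calc ‖h (j : ℝ)⁻¹‖ = ‖(1 : 𝔸) + (j : ℝ)⁻¹ • c + (h (j : ℝ)⁻¹ - 1 - (j : ℝ)⁻¹ • c)‖ := by
          congr 1; abel
      _ ≤ ‖(1 : 𝔸)‖ + ‖(j : ℝ)⁻¹ • c‖ + (j : ℝ)⁻¹ := norm_add₃_le.trans (by gcongr)
      _ = _ := by rw [norm_one, norm_smul, hn]; ring
  have hsub : Tendsto (fun j : ℕ => Real.exp (‖c‖ + 1) * (j * ‖f (j : ℝ)⁻¹ - g (j : ℝ)⁻¹‖))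
      atTop (𝓝 0) := by
    rw [← mul_zero (Real.exp (‖c‖ + 1))]
    refine Tendsto.const_mul _ ?_
    have h1 := (hf.sub hg).isLittleO
    simp only [sub_self, smul_zero, sub_zero, Pi.sub_apply, hf0, hg0] at h1
    have h2 := (h1.comp_tendsto hinv).norm_left.tendsto_div_nhds_zero
    refine h2.congr fun j => ?_
    simp [div_eq_mul_inv, mul_comm]
  refine squeeze_zero_norm' ?_ hsub
  filter_upwards [key hf hf0, key hg hg0, eventually_gt_atTop 0] with j h1 h2 hj
  have hjp : (0 : ℝ) < j := by exact_mod_cast hj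
  set K := 1 + (‖c‖ + 1) * (j : ℝ)⁻¹
  have hK1 : 1 ≤ K := le_add_of_nonneg_right (by positivity)
  have hKj : K ^ j ≤ Real.exp (‖c‖ + 1) := by
    calc K ^ j ≤ Real.exp ((‖c‖ + 1) * (j : ℝ)⁻¹) ^ j := by
          gcongr; exact (add_comm _ _).trans_le (Real.add_one_le_exp _)
      _ = _ := by rw [← Real.exp_nat_mul]; congr 1; field_simp
  calc _ ≤ ‖f (j : ℝ)⁻¹ ^ j - g (j : ℝ)⁻¹ ^ j‖ * K := le_mul_of_one_le_right (norm_nonneg _) hK1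
    _ ≤ j * K ^ j * ‖f (j : ℝ)⁻¹ - g (j : ℝ)⁻¹‖ := norm_pow_sub_pow_le h1 h2 j
    _ ≤ j * Real.exp (‖c‖ + 1) * ‖f (j : ℝ)⁻¹ - g (j : ℝ)⁻¹‖ := by gcongr
    _ = _ := by ring

/-- The **Lie product formula**. -/
theorem NormedSpace.tendsto_exp_mul_exp_pow [CompleteSpace 𝔸] (X Y : 𝔸) :
    Tendsto (fun j : ℕ => (exp ((j : ℝ)⁻¹ • X) * exp ((j : ℝ)⁻¹ • Y)) ^ j) atTop
      (𝓝 (exp (X + Y))) := by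
  let _ : NormedAlgebra ℚ 𝔸 := NormedAlgebra.restrictScalars ℚ ℝ 𝔸
  have hd (Z : 𝔸) : HasDerivAt (fun t : ℝ => exp (t • Z)) Z 0 := by
    simpa using hasDerivAt_exp_smul_const (𝕂 := ℝ) Z 0
  have hXY : HasDerivAt (fun t : ℝ => exp (t • X) * exp (t • Y)) (X + Y) 0 := by
    simpa [Pi.mul_def] using (hd X).mul (hd Y)
  have h := tendsto_pow_sub_pow_of_hasDerivAt hXY (hd (X + Y)) (by simp) (by simp)
  have h2 := h.add_const (exp (X + Y))
  rw [zero_add] at h2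
  refine h2.congr' ?_
  filter_upwards [eventually_gt_atTop 0] with j hj
  have hj' : (j : ℝ) ≠ 0 := by exact_mod_cast hj.ne'
  rw [← exp_nsmul, ← Nat.cast_smul_eq_nsmul ℝ, smul_smul, mul_inv_cancel₀ hj', one_smul,
    sub_add_cancel]

end LieTrotter

/-! ### Golden–Thompson inequality -/

section GoldenThompson

attribute [local instance] Matrix.linftyOpNormedRing Matrix.linftyOpNormedAlgebra

variable {m : Type*} [Fintype m] [DecidableEq m]

/-- The **Golden–Thompson inequality** for real symmetric matrices. -/
theorem Matrix.IsSymm.trace_exp_add_le {X Y : Matrix m m ℝ} (hX : X.IsSymm) (hY : Y.IsSymm) :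
    (NormedSpace.exp (X + Y)).trace ≤ (NormedSpace.exp X * NormedSpace.exp Y).trace := by
  -- The Lie formula needs `‖1‖ = 1`, which fails for empty matrices.
  cases isEmpty_or_nonempty m
  · simp [Matrix.trace]
  have _ : NormOneClass (Matrix m m ℝ) := Matrix.linfty_opNormOneClass
  -- The trace inequality covers only exponents `2 ^ k`, so the limit is taken along that
  -- subsequence.
  have h := (NormedSpace.tendsto_exp_mul_exp_pow X Y).comp
    (tendsto_pow_atTop_atTop_of_one_lt (one_lt_two : (1 : ℕ) < 2))
  have ht : Tendsto (fun M : Matrix m m ℝ => M.trace) (𝓝 (NormedSpace.exp (X + Y)))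
      (𝓝 (NormedSpace.exp (X + Y)).trace) :=
    (continuous_id.matrix_trace).tendsto _
  refine le_of_tendsto (ht.comp h) (Eventually.of_forall fun k => ?_)
  have he (Z : Matrix m m ℝ) :
      NormedSpace.exp (((2 ^ k : ℕ) : ℝ)⁻¹ • Z) ^ 2 ^ k = NormedSpace.exp Z := by
    rw [← Matrix.exp_nsmul, ← Nat.cast_smul_eq_nsmul ℝ, smul_smul,
      mul_inv_cancel₀ (by positivity), one_smul]
  have := Matrix.trace_mul_pow_two_pow_le k (NormedSpace.exp (((2 ^ k : ℕ) : ℝ)⁻¹ • X))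
    (NormedSpace.exp (((2 ^ k : ℕ) : ℝ)⁻¹ • Y)) (hX.smul _).exp (hY.smul _).exp
  rwa [he, he] at this

end GoldenThompson

/-! ### Klein's inequality and positivity of the exponential -/

section Klein

open scoped Matrix

variable {m : Type*} [Fintype m] [DecidableEq m]

theorem Matrix.IsSymm.exists_orthogonal_diagonalization {X : Matrix m m ℝ}
    (hX : X.IsSymm) : ∃ (U : Matrix m m ℝ) (l : m → ℝ), U * Uᵀ = 1 ∧ Uᵀ * U = 1 ∧
      X = U * Matrix.diagonal l * Uᵀ ∧
      NormedSpace.exp X = U * Matrix.diagonal (fun i => Real.exp (l i)) * Uᵀ := by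
  have hH : X.IsHermitian := by
    rw [Matrix.IsHermitian, Matrix.conjTranspose_eq_transpose_of_trivial, hX.eq]
  have h1 := (Matrix.mem_unitaryGroup_iff).1 hH.eigenvectorUnitary.2
  have h2 := (Matrix.mem_unitaryGroup_iff').1 hH.eigenvectorUnitary.2
  have h3 := hH.spectral_theorem
  rw [Unitary.conjStarAlgAut_apply] at h3
  rw [Matrix.star_eq_conjTranspose, Matrix.conjTranspose_eq_transpose_of_trivial] at h1 h2
  rw [Matrix.star_eq_conjTranspose,
    Matrix.conjTranspose_eq_transpose_of_trivial] at h3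
  refine ⟨hH.eigenvectorUnitary, hH.eigenvalues, h1, h2, h3, ?_⟩
  have h4 : (hH.eigenvectorUnitary : Matrix m m ℝ)⁻¹ = (hH.eigenvectorUnitary : Matrix m m ℝ)ᵀ :=
    Matrix.inv_eq_right_inv h1
  conv_lhs => rw [h3]
  rw [← h4, Matrix.exp_conj _ _ (IsUnit.of_mul_eq_one _ h1), Matrix.exp_diagonal]
  congr 3
  ext i
  simp [Pi.coe_exp, Real.exp_eq_exp_ℝ]

theorem Matrix.trace_diagonal_mul_conj_diagonal (W : Matrix m m ℝ) (a b : m → ℝ) :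
    (Matrix.diagonal a * (W * Matrix.diagonal b * Wᵀ)).trace =
      ∑ i, ∑ j, W i j ^ 2 * (a i * b j) := by
  simp only [Matrix.trace, Matrix.diag_apply, Matrix.diagonal_mul]
  refine Finset.sum_congr rfl fun i _ => ?_
  rw [Matrix.mul_apply, Finset.mul_sum]
  refine Finset.sum_congr rfl fun j _ => ?_
  rw [Matrix.mul_diagonal, Matrix.transpose_apply]
  ring

theorem Matrix.trace_conj_diagonal_mul_conj_diagonal (U V : Matrix m m ℝ) (a b : m → ℝ) :
    (U * Matrix.diagonal a * Uᵀ * (V * Matrix.diagonal b * Vᵀ)).trace =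
      ∑ i, ∑ j, (Uᵀ * V) i j ^ 2 * (a i * b j) := by
  rw [← Matrix.trace_diagonal_mul_conj_diagonal, Matrix.transpose_mul, Matrix.transpose_transpose,
    mul_assoc U, mul_assoc U, Matrix.trace_mul_comm]
  simp only [mul_assoc]

theorem Real.exp_tangent_gap_nonneg (s t : ℝ) :
    0 ≤ Real.exp t - Real.exp s - Real.exp s * (t - s) := by
  have h := mul_le_mul_of_nonneg_left (Real.add_one_le_exp (t - s)) (Real.exp_pos s).le
  rw [← Real.exp_add, add_sub_cancel] at h
  linarith

theorem Real.eq_of_exp_tangent_gap_eq_zero {s t : ℝ}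
    (h : Real.exp t - Real.exp s - Real.exp s * (t - s) = 0) : s = t := by
  by_contra hne
  have h1 := mul_lt_mul_of_pos_left (Real.add_one_lt_exp (sub_ne_zero.2 (Ne.symm hne)))
    (Real.exp_pos s)
  rw [← Real.exp_add, add_sub_cancel] at h1
  linarith

/-- **Klein's inequality** for the exponential, with its equality case. -/
theorem Matrix.IsSymm.klein_exp {X Y : Matrix m m ℝ} (hX : X.IsSymm) (hY : Y.IsSymm) :
    (NormedSpace.exp X).trace + (NormedSpace.exp X * (Y - X)).trace ≤ (NormedSpace.exp Y).trace ∧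
    ((NormedSpace.exp X).trace + (NormedSpace.exp X * (Y - X)).trace = (NormedSpace.exp Y).trace →
      X = Y) := by
  obtain ⟨U, l, hU1, hU2, hXU, heX⟩ := hX.exists_orthogonal_diagonalization
  obtain ⟨V, r, hV1, hV2, hYV, heY⟩ := hY.exists_orthogonal_diagonalization
  have hone : ∀ Z : Matrix m m ℝ, Z * Zᵀ = 1 → Z * Matrix.diagonal (fun _ => (1 : ℝ)) * Zᵀ = 1 := by
    intro Z hZ
    rw [Matrix.diagonal_one, mul_one, hZ]
  have t1 : (NormedSpace.exp X).trace = ∑ i, ∑ j, (Uᵀ * V) i j ^ 2 * (Real.exp (l i) * 1) := by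
    rw [← Matrix.trace_conj_diagonal_mul_conj_diagonal, hone V hV1, mul_one, heX]
  have t2 : (NormedSpace.exp Y).trace = ∑ i, ∑ j, (Uᵀ * V) i j ^ 2 * (1 * Real.exp (r j)) := by
    rw [← Matrix.trace_conj_diagonal_mul_conj_diagonal, hone U hU1, one_mul, heY]
  have t3 : (NormedSpace.exp X * Y).trace =
      ∑ i, ∑ j, (Uᵀ * V) i j ^ 2 * (Real.exp (l i) * r j) := by
    rw [← Matrix.trace_conj_diagonal_mul_conj_diagonal, heX, ← hYV]
  have t4 : (NormedSpace.exp X * X).trace =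
      ∑ i, ∑ j, (Uᵀ * V) i j ^ 2 * ((Real.exp (l i) * l i) * 1) := by
    rw [← Matrix.trace_conj_diagonal_mul_conj_diagonal, hone V hV1, mul_one, heX]
    conv_lhs => rw [hXU]
    rw [← Matrix.diagonal_mul_diagonal]
    congr 1
    calc _ = U * Matrix.diagonal (fun i => Real.exp (l i)) * (Uᵀ * U) * Matrix.diagonal l * Uᵀ := by
          simp only [mul_assoc]
      _ = _ := by rw [hU2]; simp only [mul_assoc, one_mul]
  -- In the two eigenbases the gap is a sum of scalar tangent gaps of `exp`, weighted by the squared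
  -- overlaps of eigenvectors.
  have hgap : (NormedSpace.exp Y).trace -
      ((NormedSpace.exp X).trace + (NormedSpace.exp X * (Y - X)).trace) =
      ∑ i, ∑ j, (Uᵀ * V) i j ^ 2 *
        (Real.exp (r j) - Real.exp (l i) - Real.exp (l i) * (r j - l i)) := by
    rw [mul_sub, Matrix.trace_sub, t1, t2, t3, t4]
    simp only [← Finset.sum_sub_distrib, ← Finset.sum_add_distrib]
    refine Finset.sum_congr rfl fun i _ => Finset.sum_congr rfl fun j _ => ?_
    ring
  have hpos : ∀ i j, 0 ≤ (Uᵀ * V) i j ^ 2 *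
      (Real.exp (r j) - Real.exp (l i) - Real.exp (l i) * (r j - l i)) := fun i j =>
    mul_nonneg (sq_nonneg _) (Real.exp_tangent_gap_nonneg _ _)
  refine ⟨sub_nonneg.1 (hgap ▸ Finset.sum_nonneg fun i _ => Finset.sum_nonneg fun j _ => hpos i j),
    fun heq => ?_⟩
  rw [heq, sub_self, eq_comm, Finset.sum_eq_zero_iff_of_nonneg
    fun i _ => Finset.sum_nonneg fun j _ => hpos i j] at hgap
  -- With zero gap, eigenvectors that overlap share their eigenvalue, so `Uᵀ * V` intertwines the
  -- two diagonal forms.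
  have hW : Matrix.diagonal l * (Uᵀ * V) = Uᵀ * V * Matrix.diagonal r := by
    ext i j
    rw [Matrix.diagonal_mul, Matrix.mul_diagonal, mul_comm]
    have h1 := (Finset.sum_eq_zero_iff_of_nonneg fun j _ => hpos i j).1
      (hgap i (Finset.mem_univ i)) j (Finset.mem_univ j)
    rcases mul_eq_zero.1 h1 with h | h
    · rw [pow_eq_zero_iff two_ne_zero] at h
      simp [h]
    · rw [Real.eq_of_exp_tangent_gap_eq_zero h]
  calc X = U * (Matrix.diagonal l * (Uᵀ * V)) * Vᵀ := by
        rw [hXU]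
        simp only [mul_assoc, hV1, mul_one]
    _ = (U * Uᵀ) * (V * Matrix.diagonal r * Vᵀ) := by
        rw [hW]
        simp only [mul_assoc]
    _ = Y := by rw [hU1, one_mul, ← hYV]

theorem Matrix.IsSymm.posSemidef_exp {X : Matrix m m ℝ} (hX : X.IsSymm) :
    (NormedSpace.exp X).PosSemidef := by
  obtain ⟨U, l, -, -, -, he⟩ := hX.exists_orthogonal_diagonalization
  rw [he]
  simpa using (Matrix.PosSemidef.diagonal (d := fun i => Real.exp (l i))
    fun i => (Real.exp_pos _).le).mul_mul_conjTranspose_same U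

/-- The entry is `∑ j, U i j ^ 2 * exp (l j)`, and row `i` of the orthogonal `U` is a unit vector,
hence nonzero. -/
theorem Matrix.IsSymm.exp_diag_pos {X : Matrix m m ℝ} (hX : X.IsSymm) (i : m) :
    0 < NormedSpace.exp X i i := by
  obtain ⟨U, l, h1, -, -, he⟩ := hX.exists_orthogonal_diagonalization
  have hsum (d : m → ℝ) : (U * Matrix.diagonal d * Uᵀ) i i = ∑ j, U i j ^ 2 * d j := by
    rw [Matrix.mul_apply]
    refine Finset.sum_congr rfl fun j _ => ?_
    rw [Matrix.mul_diagonal, Matrix.transpose_apply]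
    ring
  rw [he, hsum]
  refine (Finset.sum_nonneg fun j _ => by positivity).lt_of_ne' fun h0 => ?_
  rw [Finset.sum_eq_zero_iff_of_nonneg fun j _ => by positivity] at h0
  have h2 := hsum fun _ => 1
  rw [Matrix.diagonal_one, mul_one, h1, Matrix.one_apply_eq, Finset.sum_eq_zero] at h2
  · exact one_ne_zero h2
  · intro j hj
    rw [mul_one]
    exact (mul_eq_zero.1 (h0 j hj)).resolve_right (Real.exp_pos _).ne'

end Klein

/-! ### Covariance matrices from Gaussian vectors -/

theorem isCovarianceMatrix_of_posSemidef {n : ℕ} {S : Matrix (Fin n) (Fin n) ℝ}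
    (hS : S.PosSemidef) : IsCovarianceMatrix S := by
  refine ⟨EuclideanSpace ℝ (Fin n), inferInstance,
    ProbabilityTheory.multivariateGaussian 0 S, fun i x => x i, inferInstance, fun i => ?_,
    fun i j => (ProbabilityTheory.covariance_eval_multivariateGaussian hS i j).symm⟩
  exact ProbabilityTheory.IsGaussian.memLp_dual _ (EuclideanSpace.proj i) 2 (by simp)

/-! ### The potential: uniqueness, descent and coercivity -/

section ReplaceDiag

variable {n : ℕ} {A : Matrix (Fin n) (Fin n) ℝ}

theorem isSymm_replaceDiag (hA : A.IsSymm) (x : Fin n → ℝ) : (replaceDiag A x).IsSymm := by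
  ext i j
  by_cases h : i = j
  · simp [h]
  · simp [replaceDiag, h, Ne.symm h, hA.apply]

theorem replaceDiag_add (x d : Fin n → ℝ) :
    replaceDiag A (x + d) = replaceDiag A x + Matrix.diagonal d := by
  ext i j
  by_cases h : i = j
  · simp [replaceDiag, h]
  · simp [replaceDiag, h]

theorem replaceDiag_injective : Function.Injective (replaceDiag A) := fun x y h => by
  funext i
  simpa [replaceDiag] using congrFun (congrFun h i) i

theorem replaceDiag_sub (x y : Fin n → ℝ) :
    replaceDiag A y - replaceDiag A x = Matrix.diagonal (y - x) := by
  rw [sub_eq_iff_eq_add', ← replaceDiag_add, add_sub_cancel]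

theorem trace_mul_diagonal (M : Matrix (Fin n) (Fin n) ℝ) (d : Fin n → ℝ) :
    (M * Matrix.diagonal d).trace = ∑ i, M i i * d i := by
  simp [Matrix.trace, Matrix.mul_diagonal]

theorem continuous_replaceDiag : Continuous (replaceDiag A) := by
  refine continuous_matrix fun i j => ?_
  by_cases h : i = j
  · simpa [replaceDiag, h] using continuous_apply j
  · simpa [replaceDiag, h] using continuous_const

attribute [local instance] Matrix.linftyOpNormedRing Matrix.linftyOpNormedAlgebra in
theorem continuous_expReplaceDiag : Continuous (expReplaceDiag A) :=
  NormedSpace.exp_continuous.comp continuous_replaceDiag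

theorem continuous_expReplaceDiag_apply (i : Fin n) :
    Continuous fun x => expReplaceDiag A x i i :=
  continuous_expReplaceDiag.matrix_elem i i

theorem expReplaceDiag_diag_pos (hA : A.IsSymm) (x : Fin n → ℝ) (i : Fin n) :
    0 < expReplaceDiag A x i i :=
  (isSymm_replaceDiag hA x).exp_diag_pos i

/-- Klein's inequality is used in both directions: `A[y] - A[x]` is diagonal, so equal diagonals
make the two linear terms opposite and force equality. -/
theorem eq_of_expReplaceDiag_diag_eq (hA : A.IsSymm) {x y : Fin n → ℝ}
    (h : (expReplaceDiag A x).diag = (expReplaceDiag A y).diag) : x = y := by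
  have hx := isSymm_replaceDiag hA x
  have hy := isSymm_replaceDiag hA y
  have h1 := hx.klein_exp hy
  have h2 := (hy.klein_exp hx).1
  rw [replaceDiag_sub, trace_mul_diagonal] at h1 h2
  have h3 : ∑ i, NormedSpace.exp (replaceDiag A y) i i * (x - y) i =
      - ∑ i, NormedSpace.exp (replaceDiag A x) i i * (y - x) i := by
    rw [← Finset.sum_neg_distrib]
    refine Finset.sum_congr rfl fun i _ => ?_
    have : NormedSpace.exp (replaceDiag A x) i i = NormedSpace.exp (replaceDiag A y) i i :=
      congrFun h i
    rw [this, Pi.sub_apply, Pi.sub_apply]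
    ring
  rw [h3] at h2
  exact replaceDiag_injective (h1.2 (le_antisymm h1.1 (by linarith)))

/-- The convex function of `x` whose critical points solve `diag (e^{A[x]}) = v`. -/
noncomputable def diagPotential (A : Matrix (Fin n) (Fin n) ℝ) (v x : Fin n → ℝ) : ℝ :=
  (expReplaceDiag A x).trace - ∑ i, v i * x i

/-- The generalized Kullback–Leibler divergence from `diag (e^{A[x]})` to `v`. -/
noncomputable def diagDefect (A : Matrix (Fin n) (Fin n) ℝ) (v x : Fin n → ℝ) : ℝ :=
  ∑ i, (Real.exp (Real.log (expReplaceDiag A x i i)) - Real.exp (Real.log (v i)) -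
    Real.exp (Real.log (v i)) * (Real.log (expReplaceDiag A x i i) - Real.log (v i)))

theorem continuous_diagPotential (v : Fin n → ℝ) : Continuous (diagPotential A v) :=
  continuous_expReplaceDiag.matrix_trace.sub
    (continuous_finsetSum _ fun i _ => continuous_const.mul (continuous_apply i))

theorem continuous_diagDefect (hA : A.IsSymm) (v : Fin n → ℝ) : Continuous (diagDefect A v) := by
  have h (i : Fin n) : Continuous fun x => Real.log (expReplaceDiag A x i i) :=
    (continuous_expReplaceDiag_apply i).log fun x => (expReplaceDiag_diag_pos hA x i).ne'
  unfold diagDefect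
  fun_prop

theorem diagDefect_nonneg (v x : Fin n → ℝ) : 0 ≤ diagDefect A v x :=
  Finset.sum_nonneg fun _ _ => Real.exp_tangent_gap_nonneg _ _

theorem diag_eq_of_diagDefect_eq_zero (hA : A.IsSymm) {v x : Fin n → ℝ} (hv : ∀ i, 0 < v i)
    (h : diagDefect A v x = 0) : (expReplaceDiag A x).diag = v := by
  funext i
  have h1 := (Finset.sum_eq_zero_iff_of_nonneg fun i _ => Real.exp_tangent_gap_nonneg _ _).1 h i
    (Finset.mem_univ i)
  exact (Real.log_injOn_pos (hv i) (expReplaceDiag_diag_pos hA x i)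
    (Real.eq_of_exp_tangent_gap_eq_zero h1)).symm

theorem diagPotential_step_le (hA : A.IsSymm) {v : Fin n → ℝ} (hv : ∀ i, 0 < v i)
    (x : Fin n → ℝ) :
    diagPotential A v (x + (vecLog v - vecLog (expReplaceDiag A x).diag)) ≤
      diagPotential A v x - diagDefect A v x := by
  set d := vecLog v - vecLog (expReplaceDiag A x).diag with hd
  have hGT := (isSymm_replaceDiag hA x).trace_exp_add_le (Matrix.isSymm_diagonal d)
  rw [← replaceDiag_add, Matrix.exp_diagonal, trace_mul_diagonal] at hGT
  have hs : ∑ i, NormedSpace.exp (replaceDiag A x) i i * NormedSpace.exp d i = ∑ i, v i := by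
    refine Finset.sum_congr rfl fun i _ => ?_
    have hp := expReplaceDiag_diag_pos hA x i
    have he : NormedSpace.exp d i = Real.exp (d i) := by rw [Pi.coe_exp, Real.exp_eq_exp_ℝ]
    rw [he, hd, Pi.sub_apply, vecLog, vecLog, Real.exp_sub, Real.exp_log (hv i), Matrix.diag_apply,
      Real.exp_log hp]
    exact mul_div_cancel₀ _ hp.ne'
  rw [hs] at hGT
  have hdef : diagDefect A v x = (expReplaceDiag A x).trace - ∑ i, v i + ∑ i, v i * d i := by
    rw [diagDefect, Matrix.trace, ← Finset.sum_sub_distrib, ← Finset.sum_add_distrib]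
    refine Finset.sum_congr rfl fun i _ => ?_
    rw [Real.exp_log (hv i), Real.exp_log (expReplaceDiag_diag_pos hA x i), hd, Pi.sub_apply,
      vecLog, vecLog, Matrix.diag_apply]
    ring
  have hsum : ∑ i, v i * (x + d) i = ∑ i, v i * x i + ∑ i, v i * d i := by
    simp only [Pi.add_apply, mul_add, Finset.sum_add_distrib]
  rw [diagPotential, diagPotential, hdef, hsum]
  change (expReplaceDiag A (x + d)).trace ≤ _ at hGT
  linarith

/-- Klein's inequality is based at `diag x`; its linear term vanishes because `A[x] - diag x` has
zero diagonal. -/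
theorem sum_exp_sub_le_diagPotential (hA : A.IsSymm) (v x : Fin n → ℝ) :
    ∑ i, (Real.exp (x i) - v i * x i) ≤ diagPotential A v x := by
  have h := ((Matrix.isSymm_diagonal x).klein_exp (isSymm_replaceDiag hA x)).1
  have h0 : (NormedSpace.exp (Matrix.diagonal x) * (replaceDiag A x - Matrix.diagonal x)).trace
      = 0 := by
    rw [Matrix.exp_diagonal]
    simp [Matrix.trace, replaceDiag]
  have h1 : (NormedSpace.exp (Matrix.diagonal x)).trace = ∑ i, Real.exp (x i) := by
    rw [Matrix.exp_diagonal, Matrix.trace_diagonal]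
    exact Finset.sum_congr rfl fun i _ => by rw [Pi.coe_exp, Real.exp_eq_exp_ℝ]
  rw [h0, h1, add_zero] at h
  rw [Finset.sum_sub_distrib]
  exact sub_le_sub_right h _

theorem Real.sub_mul_log_le_exp_sub {a : ℝ} (ha : 0 < a) (s : ℝ) :
    a - a * Real.log a ≤ Real.exp s - a * s := by
  have h := Real.exp_tangent_gap_nonneg (Real.log a) s
  rw [Real.exp_log ha] at h
  linarith

theorem isCompact_diagPotential_sublevel (hA : A.IsSymm) {v : Fin n → ℝ} (hv : ∀ i, 0 < v i)
    (c : ℝ) : IsCompact {x | diagPotential A v x ≤ c} := by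
  set b : Fin n → ℝ := fun i => v i - v i * Real.log (v i) with hb
  set e : Fin n → ℝ := fun i => c - (∑ j, b j - b i) with he
  refine IsCompact.of_isClosed_subset (isCompact_Icc (a := fun i => -(e i / v i))
    (b := fun i => e i - ((v i + 1) - (v i + 1) * Real.log (v i + 1))))
    (isClosed_le (continuous_diagPotential v) continuous_const) fun x hx => ?_
  -- Every summand is at least its minimum `b j`, so a bound on the sum bounds each summand.
  have key (i : Fin n) : Real.exp (x i) - v i * x i ≤ e i := by
    have h1 := (sum_exp_sub_le_diagPotential hA v x).trans hx
    have h2 : ∑ j ∈ Finset.univ.erase i, b j ≤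
        ∑ j ∈ Finset.univ.erase i, (Real.exp (x j) - v j * x j) :=
      Finset.sum_le_sum fun j _ => Real.sub_mul_log_le_exp_sub (hv j) _
    rw [Finset.sum_erase_eq_sub (Finset.mem_univ i), Finset.sum_erase_eq_sub (Finset.mem_univ i)]
      at h2
    rw [he]
    linarith
  refine ⟨fun i => ?_, fun i => ?_⟩
  · rw [neg_le, le_div_iff₀ (hv i)]
    linarith [key i, Real.exp_pos (x i)]
  -- Raising the slope to `v i + 1` leaves one spare `x i`, which `key` then bounds above.
  · have h := Real.sub_mul_log_le_exp_sub (add_pos (hv i) one_pos) (x i)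
    linarith [key i]

theorem isCovarianceMatrix_expReplaceDiag (hA : A.IsSymm) (x : Fin n → ℝ) :
    IsCovarianceMatrix (expReplaceDiag A x) :=
  isCovarianceMatrix_of_posSemidef (isSymm_replaceDiag hA x).posSemidef_exp

/-! ### Convergence of the iteration -/

section Iteration

variable {v : Fin n → ℝ} {u : ℕ → Fin n → ℝ}

theorem antitone_diagPotential (hA : A.IsSymm) (hv : ∀ i, 0 < v i)
    (hu : ∀ k, u (k + 1) = u k + (vecLog v - vecLog (expReplaceDiag A (u k)).diag)) :
    Antitone fun k => diagPotential A v (u k) :=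
  antitone_nat_of_succ_le fun k => by
    rw [hu]
    linarith [diagPotential_step_le hA hv (u k), diagDefect_nonneg (A := A) v (u k)]

theorem tendsto_diagDefect (hA : A.IsSymm) (hv : ∀ i, 0 < v i)
    (hu : ∀ k, u (k + 1) = u k + (vecLog v - vecLog (expReplaceDiag A (u k)).diag)) :
    Tendsto (fun k => diagDefect A v (u k)) atTop (𝓝 0) := by
  have hbdd : BddBelow (Set.range fun k => diagPotential A v (u k)) := by
    refine ⟨∑ i, (v i - v i * Real.log (v i)), ?_⟩
    rintro _ ⟨k, rfl⟩
    exact (Finset.sum_le_sum fun i _ => Real.sub_mul_log_le_exp_sub (hv i) _).trans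
      (sum_exp_sub_le_diagPotential hA v (u k))
  have hlim := tendsto_atTop_ciInf (antitone_diagPotential hA hv hu) hbdd
  have hdiff := hlim.sub (hlim.comp (tendsto_add_atTop_nat 1))
  rw [sub_self] at hdiff
  -- The defect is at most the drop of a convergent monotone sequence over one step.
  refine squeeze_zero (fun k => diagDefect_nonneg v _) (fun k => ?_) hdiff
  have := diagPotential_step_le hA hv (u k)
  rw [← hu] at this
  simp only [Function.comp_apply]
  linarith

theorem diag_eq_of_mapClusterPt (hA : A.IsSymm) (hv : ∀ i, 0 < v i)
    (hu : ∀ k, u (k + 1) = u k + (vecLog v - vecLog (expReplaceDiag A (u k)).diag))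
    {y : Fin n → ℝ} (hy : MapClusterPt y atTop u) : (expReplaceDiag A y).diag = v := by
  refine diag_eq_of_diagDefect_eq_zero hA hv ?_
  have h1 : MapClusterPt (diagDefect A v y) atTop (diagDefect A v ∘ u) :=
    hy.continuousAt_comp (continuous_diagDefect hA v).continuousAt
  exact eq_of_nhds_neBot (NeBot.mono h1 (inf_le_inf_left _ (tendsto_diagDefect hA hv hu)))

end Iteration

end ReplaceDiag

theorem corollary2 (n : ℕ) (A : Matrix (Fin n) (Fin n) ℝ) (hA : A.IsSymm)
    (v : Fin n → ℝ) (hv : ∀ i, 0 < v i) :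
    (∃! x : Fin n → ℝ,
      IsCovarianceMatrix (expReplaceDiag A x) ∧ (expReplaceDiag A x).diag = v) ∧
    ∀ x : Fin n → ℝ,
      (IsCovarianceMatrix (expReplaceDiag A x) ∧ (expReplaceDiag A x).diag = v) →
      ∀ u : ℕ → Fin n → ℝ,
        (∀ k, u (k + 1) = u k + (vecLog v - vecLog (expReplaceDiag A (u k)).diag)) →
        Tendsto u atTop (𝓝 x) := by
  have hmem {u : ℕ → Fin n → ℝ}
      (hu : ∀ k, u (k + 1) = u k + (vecLog v - vecLog (expReplaceDiag A (u k)).diag)) (k : ℕ) :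
      u k ∈ {x | diagPotential A v x ≤ diagPotential A v (u 0)} :=
    antitone_diagPotential hA hv hu (Nat.zero_le k)
  refine ⟨?_, fun x hx u hu => ?_⟩
  -- Existence: any orbit will do, here the one from `0`.
  · let u : ℕ → Fin n → ℝ := fun k =>
      (fun x => x + (vecLog v - vecLog (expReplaceDiag A x).diag))^[k] 0
    have hu (k : ℕ) : u (k + 1) = u k + (vecLog v - vecLog (expReplaceDiag A (u k)).diag) :=
      Function.iterate_succ_apply' _ _ _
    obtain ⟨y, -, hy⟩ := (isCompact_diagPotential_sublevel hA hv _).exists_mapClusterPt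
      (f := atTop) (u := u) (tendsto_principal.2 (Eventually.of_forall (hmem hu)))
    have hyv := diag_eq_of_mapClusterPt hA hv hu hy
    exact ⟨y, ⟨isCovarianceMatrix_expReplaceDiag hA y, hyv⟩,
      fun z hz => eq_of_expReplaceDiag_diag_eq hA (hz.2.trans hyv.symm)⟩
  · exact (isCompact_diagPotential_sublevel hA hv _).tendsto_nhds_of_unique_mapClusterPt
      (Eventually.of_forall (hmem hu)) fun y _ hy =>
        eq_of_expReplaceDiag_diag_eq hA ((diag_eq_of_mapClusterPt hA hv hu hy).trans hx.2.symm)
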